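/- **Setting.** Let $\mathbb F_q$ be a finite field with $q$ elements, $\varphi:\{0,\dots,q-1\}\to\mathbb F_q$ a bijection with $\varphi(0)=0$, and $s\ge 1$ an integer. Let $Y$ be the set of all $\alpha\in\mathbb F_q[[x]]$ with $\gcd(\alpha \bmod x^m,x^m)=1$ for all $m\ge1$. For $\boldsymbol\alpha=(\alpha_1,\dots,\alpha_s)\in Y^s$ and $m\ge1$ let $R_m=\mathbb F_q[x]/(x^m)$, let $\boldsymbol\alpha^{(m)}\in R_m^s$ be the coordinatewise reduction of $\boldsymbol\alpha$ modulo $x^m$, let $\mathcal N'_{\boldsymbol\alpha^{(m)}}=\{\mathbf k\in R_m^s:\boldsymbol\alpha^{(m)}\cdot\mathbf k=0\}$, and let $$\rho(\boldsymbol\alpha^{(m)})=s-1+\min_{\mathbf k\in\mathcal N'_{\boldsymbol\alpha^{(m)}}\setminus\{\mathbf 0\}}\ \sum_{i=1}^s\deg(k_i),$$ where $\deg(k_i)$ is the degree of the representative of $k_i$ of degree less than $m$, with $\deg(0)=-1$. If $\mathcal N'_{\boldsymbol\alpha^{(m)}}=\{\mathbf 0\}$ (which happens only for $s=1$), put $\rho(\boldsymbol\alpha^{(m)})=sm$.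 *$(\mathbf T,s)$-sequences.* A $(t,m,s)$-net in base $q$ (with $0\le t\le m$) is a family of $q^m$ points of $[0,1)^s$ such that every interval $\prod_{i=1}^s[a_iq^{-d_i},(a_i+1)q^{-d_i})$ with integers $d_i\ge0$, $0\le a_i<q^{d_i}$ and of volume $q^{t-m}$ contains exactly $q^t$ of the points. Let $\mathbf T:\mathbb N_0\to\mathbb N_0$ satisfy $\mathbf T(m)\le m$ for all $m$. A sequence $(\boldsymbol x_n)_{n\ge0}$ of points of $[0,1)^s$, whose coordinates are given with $q$-adic expansions, is a $(\mathbf T,s)$-sequence in base $q$ if for all $m,k\in\mathbb N_0$ the points $\boldsymbol x_n$, $kq^m\le n<(k+1)q^m$, with all coordinates truncated to the first $m$ digits of the given expansions, form a $(\mathbf T(m),m,s)$-net. It is strict if no single value $\mathbf T(m)$ can be decreased. If coordinates equal to $1$, with all digits $q-1$, are also admitted, we speak of a $(\mathbf T,s)$-sequence in the broad sense. *Digital sequences.* Matrices $C_1,\dots,C_s\in\mathbb F_q^{\mathbb N\times\mathbb N}$ generate the sequence in which the $i$-th coordinate of the $k$-th point, $k=\kappa_0+\kappa_1q+\cdots$,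 has the digits $\varphi^{-1}(y_1),\varphi^{-1}(y_2),\dots$, where $(y_1,y_2,\dots)^\top=C_i(\varphi(\kappa_0),\varphi(\kappa_1),\dots)^\top$. If this is a (strict) $(\mathbf T,s)$-sequence in base $q$, it is called a (strict) digital $(\mathbf T,s)$-sequence over $\mathbb F_q$. *Hyperplane sequences.* For all $m\ge1$ and $1\le i\le s$ choose an ordered basis $\mathfrak b_{m,i,1},\dots,\mathfrak b_{m,i,m}$ of $R_m$ over $\mathbb F_q$ such that $\mathfrak b_{m+1,i,j}$ and $\mathfrak b_{m,i,j}$ have the same representative of degree less than $m$, and $\mathfrak b_{m+1,i,j}$ has zero coefficient at $x^m$, for $1\le j\le m$. Let $\theta_m:R_m^s\to\mathbb F_q^{sm}$ map $(k_1,\dots,k_s)$ to the concatenation of the coordinate vectors of the $k_i$ in these bases, and let $\mathcal N_{\boldsymbol\alpha^{(m)}}=\theta_m(\mathcal N'_{\boldsymbol\alpha^{(m)}})$. We say that $C_1,\dots,C_s$ generate a hyperplane sequence associated with $\boldsymbol\alpha$ (and the chosen bases) if for every $m\ge1$ the row space of $(C_1^{(m)\top}\cdots C_s^{(m)\top})\in\mathbb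 F_q^{m\times sm}$ is the orthogonal complement $\mathcal N_{\boldsymbol\alpha^{(m)}}^\perp$, where $C_i^{(m)}$ is the left upper $m\times m$ submatrix of $C_i$. **Statement.** For every $\boldsymbol\alpha\in Y^s$ there is a function $\mathbf T:\mathbb N_0\to\mathbb N_0$ with $$\mathbf T(m)=m-\rho(\boldsymbol\alpha^{(m)})\quad\text{for all } m\in\mathbb N$$ such that the following hold. 1. For some choice of the bases, there are matrices $C_1,\dots,C_s$ which generate a hyperplane sequence $\mathcal S_{\boldsymbol\alpha}$ associated with $\boldsymbol\alpha$ and for which $\mathcal S_{\boldsymbol\alpha}$ is a strict digital $(\mathbf T,s)$-sequence over $\mathbb F_q$ (with all points in $[0,1)^s$). 2. For every choice of the bases, matrices $C_1,\dots,C_s$ generating a hyperplane sequence associated with $\boldsymbol\alpha$ exist, and any such matrices generate a strict digital $(\mathbf T,s)$-sequence over $\mathbb F_q$ in the broad sense. -/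

import Mathlib

namespace HyperplaneSeq

/-! ### Nets and sequences -/

section Nets

variable {b s : ℕ}

/-- A family `P` of `b ^ m` points (counted with multiplicity) of `[0,1)^s` is a `(t,m,s)`-net in
base `b`: every elementary interval `∏ i, [a i / b ^ d i, (a i + 1) / b ^ d i)` of volume
`b ^ (t - m)`, that is, with `∑ i, d i = m - t`, contains exactly `b ^ t` of the points. -/
structure IsNet (b t m s : ℕ) (P : Fin (b ^ m) → Fin s → ℝ) : Prop where
  t_le : t ≤ m
  mem_Ico : ∀ n i, P n i ∈ Set.Ico (0 : ℝ) 1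
  card_eq : ∀ d a : Fin s → ℕ, (∀ i, a i < b ^ d i) → ∑ i, d i + t = m →
    Nat.card {n : Fin (b ^ m) // ∀ i, P n i ∈
      Set.Ico ((a i : ℝ) / (b : ℝ) ^ d i) (((a i : ℝ) + 1) / (b : ℝ) ^ d i)} = b ^ t

/-- The real number `∑_{j ≥ 1} x_j b ^ (-j)` with given base `b` expansion; the digit `x_{j+1}`
is `x j`. -/
noncomputable def value (x : ℕ → Fin b) : ℝ :=
  ∑' j, ((x j : ℕ) : ℝ) / (b : ℝ) ^ (j + 1)

/-- The truncation `[x]_{b,m}` of the given expansion. -/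
noncomputable def truncation (m : ℕ) (x : ℕ → Fin b) : ℝ :=
  ∑ j ∈ Finset.range m, ((x j : ℕ) : ℝ) / (b : ℝ) ^ (j + 1)

/-- `x` is a sequence of points with coordinates in `I`, each coordinate `x n i` being given
through a base `b` expansion. It is a `(T,s)`-sequence in base `b` if `T m ≤ m` and, for all `m`
and `k`, the truncations `[x_n]_{b,m}`, `k b ^ m ≤ n < (k + 1) b ^ m`, form a `(T m, m, s)`-net.
The usual notion is the one for `I = [0,1)`. For `I = [0,1]` one gets the same notion, except that
a coordinate all of whose digits are `b - 1` (whose value is `1`) is allowed. -/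
structure IsTSequence (I : Set ℝ) (T : ℕ → ℕ) (x : ℕ → Fin s → ℕ → Fin b) : Prop where
  T_le : ∀ m, T m ≤ m
  value_mem : ∀ n i, value (x n i) ∈ I
  isNet : ∀ m k : ℕ, IsNet b (T m) m s
    (fun n : Fin (b ^ m) => fun i => truncation m (x (k * b ^ m + n) i))

/-- A `(T,s)`-sequence is strict if no single value `T m` can be decreased. -/
structure IsStrictTSequence (I : Set ℝ) (T : ℕ → ℕ) (x : ℕ → Fin s → ℕ → Fin b) : Prop where
  isTSequence : IsTSequence I T x
  strict : ∀ m t, t < T m → ¬ IsTSequence I (Function.update T m t) x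

end Nets

/-! ### Digital sequences -/

section Digital

variable {F : Type*} [Field F] [Fintype F] {s : ℕ}

/-- The digit `κ_c` of the expansion `k = κ_0 + κ_1 q + ⋯` in base `q = |F|`. -/
def digit (F : Type*) [Field F] [Fintype F] (k c : ℕ) : Fin (Fintype.card F) :=
  ⟨k / Fintype.card F ^ c % Fintype.card F, Nat.mod_lt _ Fintype.card_pos⟩

/-- The sequence generated by the `ℕ × ℕ` matrices `C i` and the bijection `φ` between digits and
field elements, as a sequence of expansions: the digits of the `i`-th coordinate of the `k`-th
point are the `φ⁻¹` of the entries of `C i` times `(φ κ_0, φ κ_1, …)ᵀ`. The sum is finite when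
`φ` maps the digit `0` to `0`. -/
noncomputable def digitalSequence (φ : Fin (Fintype.card F) ≃ F) (C : Fin s → Matrix ℕ ℕ F) :
    ℕ → Fin s → ℕ → Fin (Fintype.card F) :=
  fun k i r => φ.symm (∑ᶠ c, C i r c * φ (digit F k c))

end Digital

/-! ### Duality -/

section Duality

variable {F : Type*} [Field F] {s : ℕ}

/-- The dual space of a subspace of `F ^ (s m)`; vectors are written as `s` blocks of length
`m`. -/
def dualSpace {m : ℕ} (N : Submodule F (Fin s → Fin m → F)) :
    Submodule F (Fin s → Fin m → F) where
  carrier := {A | ∀ B ∈ N, ∑ i, ∑ j, B i j * A i j = 0}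
  zero_mem' := by intro B _; simp
  add_mem' := by
    intro A A' hA hA' B hB
    simp only [Pi.add_apply, mul_add, Finset.sum_add_distrib, hA B hB, hA' B hB, add_zero]
  smul_mem' := by
    intro c A hA B hB
    have h := hA B hB
    simp only [Pi.smul_apply, smul_eq_mul, mul_left_comm _ c, ← Finset.mul_sum, h, mul_zero]

/-- The row space of the overall generating matrix `(C_1^{(m)ᵀ} ⋯ C_s^{(m)ᵀ})`, where `C_i^{(m)}`
is the left upper `m × m` submatrix of `C_i`. -/
def rowSpace (C : Fin s → Matrix ℕ ℕ F) (m : ℕ) : Submodule F (Fin s → Fin m → F) :=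
  Submodule.span F (Set.range fun c : Fin m => fun (i : Fin s) (r : Fin m) => C i r c)

end Duality

/-! ### Hyperplane sequences -/

section Hyperplane

open Polynomial

variable {F : Type*} [Field F] {s : ℕ}

/-- The residue class ring `R_m = F[x] / (x ^ m)`. -/
abbrev R (F : Type*) [Field F] (m : ℕ) : Type _ := AdjoinRoot (X ^ m : F[X])

/-- The representative of degree less than `m` of a residue class modulo `x ^ m`. -/
noncomputable def rep {m : ℕ} (k : R F m) : F[X] :=
  AdjoinRoot.modByMonicHom (monic_X_pow m) k

/-- The degree of a residue class modulo `x ^ m`, with `deg 0 = -1`. -/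
noncomputable def deg {m : ℕ} (k : R F m) : ℤ :=
  open Classical in if k = 0 then -1 else ((rep k).natDegree : ℤ)

/-- The set `Y` of power series whose reductions modulo all `x ^ m` are coprime to `x ^ m`. -/
def Y (F : Type*) [Field F] : Set (PowerSeries F) :=
  {α | ∀ m : ℕ, 1 ≤ m → IsCoprime (PowerSeries.trunc m α) (X ^ m : F[X])}

/-- The reduction `α^{(m)}` of a vector of power series modulo `x ^ m`. -/
noncomputable def red (α : Fin s → PowerSeries F) (m : ℕ) : Fin s → R F m :=
  fun i => AdjoinRoot.mk (X ^ m) (PowerSeries.trunc m (α i))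

/-- The space `N'_a` of all `k ∈ R_m ^ s` with `a · k = 0` in `R_m`. -/
def hyperplane {m : ℕ} (a : Fin s → R F m) : Submodule F (Fin s → R F m) where
  carrier := {k | ∑ i, a i * k i = 0}
  zero_mem' := by simp
  add_mem' := by
    intro k l hk hl
    simp only [Set.mem_ofPred_eq] at hk hl ⊢
    simp only [Pi.add_apply, mul_add, Finset.sum_add_distrib, hk, hl, add_zero]
  smul_mem' := by
    intro c k hk
    simp only [Set.mem_ofPred_eq] at hk ⊢
    simp only [Pi.smul_apply, mul_smul_comm, ← Finset.smul_sum, hk, smul_zero]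

/-- The figure of merit `ρ(a) = s - 1 + min ∑ i, deg (k i)` over the nonzero `k ∈ N'_a`. By
convention it is `s m` when `N'_a = 0` (for the vectors `a` of units this occurs only if
`s = 1`), which corresponds to the convention that the zero space has minimum distance
`s m + 1`. -/
noncomputable def figureOfMerit {m : ℕ} (a : Fin s → R F m) : ℤ :=
  open Classical in
  if hyperplane a = ⊥ then (s : ℤ) * m
  else (s : ℤ) - 1 + sInf {n : ℤ | ∃ k ∈ hyperplane a, k ≠ 0 ∧ n = ∑ i, deg (k i)}

/-- A choice of ordered bases `b_{m,i,1}, …, b_{m,i,m}` of all the `R_m`, for `i = 1, …, s`, with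
`b_{m+1,i,j} = (b_{m,i,j}, 0)` in the coordinates with respect to `1, x, x², …`. (For `m = 0` the
ring is zero and the basis is empty.) -/
structure BasisSystem (F : Type*) [Field F] (s : ℕ) where
  basis : ∀ m : ℕ, Fin s → Module.Basis (Fin m) F (R F m)
  compatible : ∀ (m : ℕ) (i : Fin s) (j : Fin m),
    rep (basis (m + 1) i j.castSucc) = rep (basis m i j)

/-- The map `θ_m` taking `k ∈ R_m ^ s` to the coordinate vectors of the `k i` in the chosen
bases. -/
noncomputable def BasisSystem.theta (B : BasisSystem F s) (m : ℕ) :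
    (Fin s → R F m) ≃ₗ[F] (Fin s → Fin m → F) :=
  LinearEquiv.piCongrRight fun i => (B.basis m i).equivFun

/-- The space `N_{α^{(m)}} = θ_m (N'_{α^{(m)}})`. -/
noncomputable def BasisSystem.space (B : BasisSystem F s) (α : Fin s → PowerSeries F) (m : ℕ) :
    Submodule F (Fin s → Fin m → F) :=
  (hyperplane (red α m)).map (B.theta m).toLinearMap

/-- `C` are generating matrices of a hyperplane sequence associated with `α` (for the chosen
bases): for all `m ≥ 1` the row space of the `m`-th overall generating matrix is the dual space of
`N_{α^{(m)}}`. -/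
def IsHyperplaneGenerating (B : BasisSystem F s) (α : Fin s → PowerSeries F)
    (C : Fin s → Matrix ℕ ℕ F) : Prop :=
  ∀ m : ℕ, 1 ≤ m → rowSpace C m = dualSpace (B.space α m)

end Hyperplane

end HyperplaneSeq

/-! The first `d` digits of a coordinate decide which elementary interval of order `d` contains its
truncation. Counting the points of a block `k q ^ m ≤ n < (k + 1) q ^ m` in an elementary box
therefore means counting the solutions of a linear system whose equations are the first `d i` rows
of the truncated matrices; the digits of `k` only shift the right-hand side. All counts equal `q ^
t` exactly when these rows are independent for every `d` with `∑ i, d i = m - t`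
(`isNet_digitalSequence_iff`).

A relation among rows is a vector orthogonal to the row space. For a hyperplane sequence, double
duality turns it into the coordinate vector of some `k` in the hyperplane of `α` modulo `x ^ m`.
Compatible bases respect the filtration by degree, so the relation involves only the first `d i`
rows exactly when `deg (k i) < d i`. Independence for all `d` of sum `m - t` thus means `m - t ≤ ρ`
(`IsHyperplaneGenerating.independent_iff`). Being an equivalence, this gives both the net property
for `t = m - ρ` and its failure for smaller `t`, hence strictness.

Since the `α i` are units modulo `x ^ m`, one has `ρ ≤ m`, so `m - ρ` is a natural number.
Generating matrices are read off from the coefficients of `α i` times the basis polynomials. For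
monomial bases they are upper triangular, so every coordinate has a finite expansion and stays below
`1`. -/

namespace HyperplaneSeq

/-! ### Digit expansions and elementary intervals -/

section Expansions

variable {b : ℕ}

/-- The integer whose base `b` digits are the first `d` digits of the expansion `x`. -/
def leadingPart (x : ℕ → Fin b) : ℕ → ℕ
  | 0 => 0
  | d + 1 => b * leadingPart x d + x d

theorem leadingPart_lt (x : ℕ → Fin b) (d : ℕ) : leadingPart x d < b ^ d := by
  induction d with
  | zero => simp [leadingPart]
  | succ d ih =>
    have h := (x d).isLt
    calc b * leadingPart x d + x d < b * (leadingPart x d + 1) := by rw [mul_add, mul_one]; omega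
      _ ≤ b * b ^ d := Nat.mul_le_mul_left _ ih
      _ = b ^ (d + 1) := (pow_succ' b d).symm

theorem leadingPart_eq_iff (x y : ℕ → Fin b) (d : ℕ) :
    leadingPart x d = leadingPart y d ↔ ∀ j < d, x j = y j := by
  induction d with
  | zero => simp [leadingPart]
  | succ d ih =>
    have hb : 0 < b := (x d).pos
    rw [Nat.forall_lt_succ_right, ← ih]
    constructor
    · intro h
      simp only [leadingPart] at h
      refine ⟨?_, Fin.ext ?_⟩
      · have := congrArg (· / b) h
        simpa [Nat.mul_add_div hb, Nat.div_eq_of_lt (x d).isLt, Nat.div_eq_of_lt (y d).isLt]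
          using this
      · have := congrArg (· % b) h
        simpa [Nat.mul_add_mod, Nat.mod_eq_of_lt] using this
    · rintro ⟨h, h'⟩
      simp only [leadingPart, h, h']

theorem exists_leadingPart_eq (hb : 0 < b) (d a : ℕ) (ha : a < b ^ d) :
    ∃ x : ℕ → Fin b, leadingPart x d = a := by
  induction d generalizing a with
  | zero => exact ⟨fun _ => ⟨0, hb⟩, by simp [leadingPart] at ha ⊢; omega⟩
  | succ d ih =>
    obtain ⟨x, hx⟩ := ih (a / b) (by
      rw [Nat.div_lt_iff_lt_mul hb, ← pow_succ]; exact ha)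
    refine ⟨Function.update x d ⟨a % b, Nat.mod_lt _ hb⟩, ?_⟩
    have h : leadingPart (Function.update x d ⟨a % b, Nat.mod_lt _ hb⟩) d = leadingPart x d :=
      (leadingPart_eq_iff _ _ d).2 fun j hj => Function.update_of_ne hj.ne _ _
    simp only [leadingPart, h, hx, Function.update_self]
    exact Nat.div_add_mod a b

theorem truncation_eq_leadingPart (x : ℕ → Fin b) (d : ℕ) :
    truncation d x = (leadingPart x d : ℝ) / (b : ℝ) ^ d := by
  have hb : (b : ℝ) ≠ 0 := Nat.cast_ne_zero.2 (x 0).pos.ne'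
  induction d with
  | zero => simp [truncation, leadingPart]
  | succ d ih =>
    rw [truncation, Finset.sum_range_succ, ← truncation, ih, leadingPart]
    push_cast
    field_simp
    ring

theorem truncation_mono (x : ℕ → Fin b) : Monotone fun m => truncation m x := by
  refine monotone_nat_of_le_succ fun m => ?_
  rw [truncation, truncation, Finset.sum_range_succ]
  exact le_add_of_nonneg_right (by positivity)

/-- These are the right endpoints of the nested elementary intervals around `x`. They do not
increase because a digit is at most `b - 1`. -/
theorem truncation_add_inv_pow_antitone (x : ℕ → Fin b) :
    Antitone fun m => truncation m x + ((b : ℝ) ^ m)⁻¹ := by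
  refine antitone_nat_of_succ_le fun m => ?_
  have hb : (0 : ℝ) < b := Nat.cast_pos.2 (x 0).pos
  have h : (((x m : ℕ) : ℝ) + 1) ≤ b := by exact_mod_cast (x m).isLt
  have h2 : ((x m : ℕ) : ℝ) / (b : ℝ) ^ (m + 1) + ((b : ℝ) ^ (m + 1))⁻¹ ≤ ((b : ℝ) ^ m)⁻¹ := by
    rw [div_add' _ _ _ (by positivity), inv_mul_cancel₀ (by positivity), pow_succ,
      div_le_iff₀ (by positivity), ← mul_assoc, inv_mul_cancel₀ (by positivity), one_mul]
    exact h
  simp only [truncation, Finset.sum_range_succ] at h2 ⊢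
  linarith

theorem truncation_nonneg (x : ℕ → Fin b) (m : ℕ) : 0 ≤ truncation m x :=
  Finset.sum_nonneg fun _ _ => by positivity

theorem truncation_lt_one (x : ℕ → Fin b) (m : ℕ) : truncation m x < 1 := by
  have h := truncation_add_inv_pow_antitone x (Nat.zero_le m)
  have hb : (0 : ℝ) < b := Nat.cast_pos.2 (x 0).pos
  have h2 : (0 : ℝ) < ((b : ℝ) ^ m)⁻¹ := by positivity
  simp only [truncation, Finset.range_zero, Finset.sum_empty, pow_zero, inv_one] at h ⊢
  linarith

theorem value_mem_Icc (x : ℕ → Fin b) : value x ∈ Set.Icc (0 : ℝ) 1 :=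
  ⟨tsum_nonneg fun _ => by positivity,
    Real.tsum_le_of_sum_range_le (fun _ => by positivity) fun m => (truncation_lt_one x m).le⟩

/-- A finite expansion equals one of its truncations, which excludes the value `1`. -/
theorem value_mem_Ico (x : ℕ → Fin b) (M : ℕ) (hx : ∀ j, M ≤ j → (x j : ℕ) = 0) :
    value x ∈ Set.Ico (0 : ℝ) 1 := by
  have h : value x = truncation M x :=
    tsum_eq_sum fun j hj => by rw [hx j (by simpa using hj)]; simp
  exact h ▸ ⟨truncation_nonneg x M, truncation_lt_one x M⟩

/-- The elementary interval of order `d` that contains a truncated expansion is determined by the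
first `d` digits. -/
theorem truncation_mem_Ico_iff (x y : ℕ → Fin b) {d m : ℕ} (hdm : d ≤ m) :
    truncation m x ∈ Set.Ico ((leadingPart y d : ℝ) / (b : ℝ) ^ d)
      (((leadingPart y d : ℝ) + 1) / (b : ℝ) ^ d) ↔ ∀ j < d, x j = y j := by
  have hb : (0 : ℝ) < b := Nat.cast_pos.2 (x 0).pos
  have hd : (0 : ℝ) < (b : ℝ) ^ d := by positivity
  have hm : (0 : ℝ) < ((b : ℝ) ^ m)⁻¹ := by positivity
  have h1 : truncation d x ≤ truncation m x := truncation_mono x hdm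
  have h2 : truncation m x + ((b : ℝ) ^ m)⁻¹ ≤ truncation d x + ((b : ℝ) ^ d)⁻¹ :=
    truncation_add_inv_pow_antitone x hdm
  rw [truncation_eq_leadingPart x d] at h1 h2
  have h3 : truncation m x < ((leadingPart x d : ℝ) + 1) / (b : ℝ) ^ d := by
    rw [add_div, one_div]; linarith
  rw [← leadingPart_eq_iff, Set.mem_Ico]
  constructor
  · rintro ⟨h4, h5⟩
    -- Two intervals of order `d` with a common point have integer numerators that differ by less
    -- than `1`.
    have h6 := (div_lt_div_iff_of_pos_right hd).1 (h1.trans_lt h5)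
    have h7 := (div_lt_div_iff_of_pos_right hd).1 (h4.trans_lt h3)
    norm_cast at h6 h7
    omega
  · intro h
    rw [← h]
    exact ⟨h1, h3⟩

end Expansions
end HyperplaneSeq
namespace HyperplaneSeq

/-! ### Counting solutions of linear systems -/

section LinearSystems

open Matrix

variable {F J : Type*} [Field F] [Fintype J] {m t : ℕ}

/-- Row rank equals column rank: independent rows give rank `|J|`, so the columns span the whole
space. -/
theorem mulVec_surjective_of_vecMul_eq_zero (M : Matrix J (Fin m) F)
    (h : ∀ u, u ᵥ* M = 0 → u = 0) : Function.Surjective M.mulVec := by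
  have hinj : Function.Injective M.vecMul := fun u v huv => by
    have := h (u - v) (by rw [sub_vecMul]; exact sub_eq_zero.2 huv)
    exact sub_eq_zero.1 this
  have hrank := (vecMul_injective_iff.1 hinj).rank_matrix
  have htop : LinearMap.range M.mulVecLin = ⊤ :=
    Submodule.eq_top_of_finrank_eq (by rw [Module.finrank_fintype_fun_eq_card]; exact hrank)
  exact LinearMap.range_eq_top.1 htop

/-- A linear system has the same number `q ^ t` of solutions for all right hand sides if and only
if its equations are linearly independent. -/
theorem card_solutions_iff [Fintype F] (M : Matrix J (Fin m) F) (hJ : Fintype.card J + t = m) :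
    (∀ w, Nat.card {z // M *ᵥ z = w} = Fintype.card F ^ t) ↔ ∀ u, u ᵥ* M = 0 → u = 0 := by
  constructor
  · intro h u hu
    -- Positive counts make every `w` of the form `M z`, so a relation `u` among the rows is
    -- orthogonal to every vector.
    refine dotProduct_eq_zero u fun w => ?_
    have hpos : 0 < Nat.card {z // M *ᵥ z = w} := by
      rw [h w]; exact pow_pos Fintype.card_pos t
    obtain ⟨⟨z, rfl⟩⟩ := (Nat.card_pos_iff.1 hpos).1
    rw [dotProduct_mulVec, hu, zero_dotProduct]
  · intro h w
    have hsurj := mulVec_surjective_of_vecMul_eq_zero M h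
    obtain ⟨z₀, rfl⟩ := hsurj w
    -- A nonempty solution set is a translate of the kernel, whose dimension is `m - |J| = t`.
    have e : {z // M *ᵥ z = M *ᵥ z₀} ≃ LinearMap.ker M.mulVecLin :=
      (Equiv.subRight z₀).subtypeEquiv fun z => by
        simp [mulVec_sub, sub_eq_zero]
    have hker := LinearMap.finrank_range_add_finrank_ker M.mulVecLin
    rw [LinearMap.range_eq_top.2 hsurj, finrank_top, Module.finrank_fintype_fun_eq_card,
      Module.finrank_fintype_fun_eq_card, Fintype.card_fin] at hker
    rw [Nat.card_congr e, Module.natCard_eq_pow_finrank (K := F), Nat.card_eq_fintype_card]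
    congr 1
    omega

end LinearSystems

/-! ### The net property as independence of leading rows -/

section Nets

open Matrix

variable {F : Type*} [Field F] [Fintype F] {s : ℕ}

theorem digit_eq_zero {k c : ℕ} (h : k < Fintype.card F ^ c) :
    digit F k c = ⟨0, Fintype.card_pos⟩ := by
  simp [digit, Nat.div_eq_of_lt h]

theorem digit_mul_pow_add_of_lt {m n k c : ℕ} (hc : c < m) :
    digit F (k * Fintype.card F ^ m + n) c = digit F n c := by
  have hq : 0 < Fintype.card F := Fintype.card_pos
  obtain ⟨e, rfl⟩ := Nat.exists_eq_add_of_lt hc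
  refine Fin.ext ?_
  simp only [digit]
  rw [show k * Fintype.card F ^ (c + e + 1) + n
      = n + Fintype.card F ^ c * (Fintype.card F * (k * Fintype.card F ^ e)) by ring,
    Nat.add_mul_div_left _ _ (pow_pos hq c), Nat.add_mul_mod_self_left]

theorem digit_mul_pow_add {m n k c : ℕ} (hn : n < Fintype.card F ^ m) :
    digit F (k * Fintype.card F ^ m + n) (m + c) = digit F k c := by
  have hq : 0 < Fintype.card F := Fintype.card_pos
  refine Fin.ext ?_
  simp only [digit]
  rw [pow_add, ← Nat.div_div_eq_div_mul, mul_comm k, Nat.mul_add_div (pow_pos hq m),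
    Nat.div_eq_of_lt hn, add_zero]

theorem finsum_digit_eq_sum (φ : Fin (Fintype.card F) ≃ F) (hφ : φ ⟨0, Fintype.card_pos⟩ = 0)
    (a : ℕ → F) {k M : ℕ} (hM : k < Fintype.card F ^ M) :
    ∑ᶠ c, a c * φ (digit F k c) = ∑ c ∈ Finset.range M, a c * φ (digit F k c) := by
  refine finsum_eq_sum_of_support_subset _ fun c hc => ?_
  by_contra h
  have hMc : M ≤ c := by simpa using h
  refine hc ?_
  beta_reduce
  rw [digit_eq_zero (hM.trans_le (Nat.pow_le_pow_right Fintype.card_pos hMc)), hφ, mul_zero]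

/-- Within a block only the first `m` digits vary. The second sum depends on `k` alone, so it acts
as a constant shift. -/
theorem finsum_digit_mul_pow_add (φ : Fin (Fintype.card F) ≃ F)
    (hφ : φ ⟨0, Fintype.card_pos⟩ = 0) (a : ℕ → F) {m n k : ℕ} (hn : n < Fintype.card F ^ m) :
    ∑ᶠ c, a c * φ (digit F (k * Fintype.card F ^ m + n) c)
      = ∑ c : Fin m, a c * φ (digit F n c) + ∑ᶠ c, a (m + c) * φ (digit F k c) := by
  -- A crude bound on the number of digits of `k` suffices to make both sums finite.
  have hk : k < Fintype.card F ^ k := Nat.lt_pow_self Fintype.one_lt_card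
  have hlt : k * Fintype.card F ^ m + n < Fintype.card F ^ (m + k) := by
    calc _ < (k + 1) * Fintype.card F ^ m := by rw [add_mul, one_mul]; omega
      _ ≤ Fintype.card F ^ k * Fintype.card F ^ m := Nat.mul_le_mul_right _ hk
      _ = _ := by rw [← pow_add, add_comm]
  rw [finsum_digit_eq_sum φ hφ _ hlt, finsum_digit_eq_sum φ hφ (fun c => a (m + c)) hk,
    Finset.sum_range_add, Finset.sum_range]
  congr 1
  · exact Finset.sum_congr rfl fun c _ => by rw [digit_mul_pow_add_of_lt c.isLt]
  · exact Finset.sum_congr rfl fun c _ => by rw [digit_mul_pow_add hn]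

/-- The vector of the first `m` digits, as field elements, of a number less than `q ^ m`. -/
noncomputable def digitVector (φ : Fin (Fintype.card F) ≃ F) (m : ℕ) :
    Fin (Fintype.card F ^ m) ≃ (Fin m → F) :=
  finFunctionFinEquiv.symm.trans (Equiv.arrowCongr (Equiv.refl _) φ)

theorem card_subtype_lt {m : ℕ} (d : Fin s → ℕ) (hd : ∀ i, d i ≤ m) :
    Fintype.card {p : Fin s × Fin m // (p.2 : ℕ) < d p.1} = ∑ i, d i := by
  rw [Fintype.card_subtype, Finset.card_filter, Fintype.sum_prod_type]
  refine Finset.sum_congr rfl fun i _ => ?_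
  rw [← Finset.card_filter]
  exact Fin.card_filter_val_lt.trans (min_eq_right (hd i))

/-- The points `k q ^ m ≤ n < (k + 1) q ^ m` of a digital sequence, truncated to `m` digits, form a
`(t, m, s)`-net if and only if any choice of `m - t` leading rows of the generating matrices is
linearly independent. -/
theorem isNet_digitalSequence_iff (φ : Fin (Fintype.card F) ≃ F)
    (hφ : φ ⟨0, Fintype.card_pos⟩ = 0) (C : Fin s → Matrix ℕ ℕ F) {t m : ℕ} (htm : t ≤ m) (k : ℕ) :
    IsNet (Fintype.card F) t m s (fun n : Fin (Fintype.card F ^ m) => fun i =>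
        truncation m (digitalSequence φ C (k * Fintype.card F ^ m + n) i)) ↔
      ∀ d : Fin s → ℕ, ∑ i, d i + t = m → ∀ A : Fin s → Fin m → F,
        (∀ i (r : Fin m), d i ≤ r → A i r = 0) →
        (∀ c : Fin m, ∑ i, ∑ r : Fin m, C i r c * A i r = 0) → A = 0 := by
  have key : ∀ d : Fin s → ℕ, ∑ i, d i + t = m →
      ((∀ a : Fin s → ℕ, (∀ i, a i < Fintype.card F ^ d i) →
        Nat.card {n : Fin (Fintype.card F ^ m) // ∀ i,
          truncation m (digitalSequence φ C (k * Fintype.card F ^ m + n) i) ∈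
          Set.Ico ((a i : ℝ) / (Fintype.card F : ℝ) ^ d i)
            (((a i : ℝ) + 1) / (Fintype.card F : ℝ) ^ d i)} = Fintype.card F ^ t) ↔
      ∀ A : Fin s → Fin m → F, (∀ i (r : Fin m), d i ≤ r → A i r = 0) →
        (∀ c : Fin m, ∑ i, ∑ r : Fin m, C i r c * A i r = 0) → A = 0) := by
    intro d hd
    have hdm : ∀ i, d i ≤ m := fun i =>
      (Finset.single_le_sum (fun _ _ => Nat.zero_le _) (Finset.mem_univ i)).trans
        (by omega : ∑ i, d i ≤ m)
    let M : Matrix {p : Fin s × Fin m // (p.2 : ℕ) < d p.1} (Fin m) F :=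
      fun p c => C p.1.1 p.1.2 c
    -- The shift caused by the digits of `k`. It moves the right-hand side but not the matrix `M`,
    -- so the criterion does not depend on `k`.
    let v : {p : Fin s × Fin m // (p.2 : ℕ) < d p.1} → F :=
      fun p => ∑ᶠ c, C p.1.1 p.1.2 (m + c) * φ (digit F k c)
    have hcount : ∀ y : Fin s → ℕ → Fin (Fintype.card F),
        Nat.card {n : Fin (Fintype.card F ^ m) // ∀ i,
          truncation m (digitalSequence φ C (k * Fintype.card F ^ m + n) i) ∈
          Set.Ico ((leadingPart (y i) (d i) : ℝ) / (Fintype.card F : ℝ) ^ d i)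
            (((leadingPart (y i) (d i) : ℝ) + 1) / (Fintype.card F : ℝ) ^ d i)} =
        Nat.card {z // M *ᵥ z = fun p => φ (y p.1.1 p.1.2) - v p} := by
      intro y
      refine Nat.card_congr ((digitVector φ m).subtypeEquiv fun n => ?_)
      simp only [truncation_mem_Ico_iff _ _ (hdm _)]
      have hdig : ∀ i r, digitalSequence φ C (k * Fintype.card F ^ m + n) i r = y i r ↔
          ∑ c : Fin m, C i r c * digitVector φ m n c = φ (y i r) -
            ∑ᶠ c, C i r (m + c) * φ (digit F k c) := by
        intro i r
        rw [digitalSequence, Equiv.symm_apply_eq, finsum_digit_mul_pow_add φ hφ _ n.isLt,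
          eq_sub_iff_add_eq]
        rfl
      simp only [hdig]
      constructor
      · intro h
        ext p
        exact h _ _ p.2
      · intro h i r hr
        exact congrFun h ⟨(i, ⟨r, hr.trans_le (hdm i)⟩), hr⟩
    have hsystem : (∀ a : Fin s → ℕ, (∀ i, a i < Fintype.card F ^ d i) →
        Nat.card {n : Fin (Fintype.card F ^ m) // ∀ i,
          truncation m (digitalSequence φ C (k * Fintype.card F ^ m + n) i) ∈
          Set.Ico ((a i : ℝ) / (Fintype.card F : ℝ) ^ d i)
            (((a i : ℝ) + 1) / (Fintype.card F : ℝ) ^ d i)} = Fintype.card F ^ t) ↔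
        ∀ w, Nat.card {z // M *ᵥ z = w} = Fintype.card F ^ t := by
      constructor
      · intro h w
        -- Digits whose interval corresponds to the right-hand side `w`; those beyond the first `d
        -- i` are irrelevant.
        let y : Fin s → ℕ → Fin (Fintype.card F) := fun i r =>
          if hr : r < m then
            if hr' : r < d i then φ.symm (w ⟨(i, ⟨r, hr⟩), hr'⟩ + v ⟨(i, ⟨r, hr⟩), hr'⟩)
            else ⟨0, Fintype.card_pos⟩
          else ⟨0, Fintype.card_pos⟩
        have hw : (fun p : {p : Fin s × Fin m // (p.2 : ℕ) < d p.1} =>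
            φ (y p.1.1 p.1.2) - v p) = w := by
          ext p
          simp only [y, p.2, p.1.2.isLt, dif_pos, Equiv.apply_symm_apply]
          exact add_sub_cancel_right _ _
        rw [← hw, ← hcount]
        exact h _ fun i => leadingPart_lt _ _
      · intro h a ha
        choose y hy using fun i => exists_leadingPart_eq Fintype.card_pos (d i) (a i) (ha i)
        simp only [← hy]
        rw [hcount, h]
    rw [hsystem, card_solutions_iff M (by rw [card_subtype_lt d hdm, hd])]
    -- Relations among the selected rows are full coefficient vectors that vanish on all other rows.
    have hsum : ∀ A : Fin s → Fin m → F, (∀ i (r : Fin m), d i ≤ r → A i r = 0) →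
        ∀ c : Fin m, ((fun p : {p : Fin s × Fin m // (p.2 : ℕ) < d p.1} => A p.1.1 p.1.2) ᵥ* M) c
          = ∑ i, ∑ r : Fin m, C i r c * A i r := by
      intro A hA c
      rw [← Fintype.sum_prod_type' (f := fun i (r : Fin m) => C i r c * A i r), vecMul, dotProduct]
      simp only [M, mul_comm (A _ _)]
      rw [← Fintype.sum_subtype_add_sum_subtype (fun p : Fin s × Fin m => (p.2 : ℕ) < d p.1),
        Finset.sum_eq_zero (s := (Finset.univ :
          Finset {p : Fin s × Fin m // ¬ (p.2 : ℕ) < d p.1})), add_zero]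
      exact fun p _ => by rw [hA _ _ (not_lt.1 p.2), mul_zero]
    constructor
    · intro h A hA hC
      have h0 := h (fun p => A p.1.1 p.1.2) (funext fun c => (hsum A hA c).trans (hC c))
      ext i r
      by_cases hr : (r : ℕ) < d i
      · exact congrFun h0 ⟨(i, r), hr⟩
      · exact hA i r (not_lt.1 hr)
    · intro h u hu
      let A : Fin s → Fin m → F := fun i r => if hr : (r : ℕ) < d i then u ⟨(i, r), hr⟩ else 0
      have hA : ∀ i (r : Fin m), d i ≤ r → A i r = 0 := fun i r hr => dif_neg (not_lt.2 hr)
      have hAu : (fun p : {p : Fin s × Fin m // (p.2 : ℕ) < d p.1} => A p.1.1 p.1.2) = u :=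
        funext fun p => dif_pos p.2
      have h0 := h A hA fun c => by rw [← hsum A hA, hAu, hu]; rfl
      rw [← hAu, h0]
      rfl
  constructor
  · intro h d hd
    exact (key d hd).1 fun a ha => h.card_eq d a ha hd
  · intro h
    exact ⟨htm, fun n i => ⟨truncation_nonneg _ _, truncation_lt_one _ _⟩,
      fun d a ha hd => (key d hd).2 (h d hd) a ha⟩

end Nets
end HyperplaneSeq
namespace HyperplaneSeq

/-! ### Double duality -/

section Duality

variable {F : Type*} [Field F] {s m : ℕ}

theorem dualSpace_dualSpace (N : Submodule F (Fin s → Fin m → F)) :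
    dualSpace (dualSpace N) = N := by
  let β : LinearMap.BilinForm F (Fin s → Fin m → F) :=
    LinearMap.mk₂ F (fun A A' => ∑ i, ∑ j, A i j * A' i j)
      (by intros; simp [add_mul, Finset.sum_add_distrib])
      (by intros; simp [mul_assoc, Finset.mul_sum])
      (by intros; simp [mul_add, Finset.sum_add_distrib])
      (by intros; simp [mul_left_comm, Finset.mul_sum])
  have hβ : ∀ A A', β A A' = ∑ i, ∑ j, A i j * A' i j := fun _ _ => rfl
  have hsymm : ∀ A A', β A A' = β A' A := fun A A' => by simp only [hβ, mul_comm]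
  have hrefl : β.IsRefl := fun A A' h => by rw [hsymm, h]
  have hsep : ∀ A, (∀ A', β A A' = 0) → A = 0 := by
    intro A hA
    ext i j
    have := hA (Pi.single i (Pi.single j 1))
    rw [hβ, Fintype.sum_eq_single i (fun i' hi' => by simp [hi']),
      Fintype.sum_eq_single j (fun j' hj' => by simp [hj'])] at this
    simpa using this
  have hnondeg : β.Nondegenerate :=
    ⟨hsep, fun A hA => hsep A fun A' => by rw [hsymm]; exact hA A'⟩
  have hdual : ∀ N, dualSpace N = β.orthogonal N := fun _ => rfl
  rw [hdual, hdual, LinearMap.BilinForm.orthogonal_orthogonal hnondeg hrefl]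

theorem mem_dualSpace_rowSpace (C : Fin s → Matrix ℕ ℕ F) (A : Fin s → Fin m → F) :
    A ∈ dualSpace (rowSpace C m) ↔ ∀ c : Fin m, ∑ i, ∑ r : Fin m, C i r c * A i r = 0 := by
  constructor
  · exact fun h c => h _ (Submodule.subset_span ⟨c, rfl⟩)
  · intro h
    -- Orthogonality is symmetric, so the claim can be tested on the generators of the row space.
    have hle : rowSpace C m ≤ dualSpace (F := F) (Submodule.span F {A}) := by
      refine Submodule.span_le.2 ?_
      rintro _ ⟨c, rfl⟩ D hD
      obtain ⟨a, rfl⟩ := Submodule.mem_span_singleton.1 hD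
      have := congrArg (a * ·) (h c)
      simpa [Finset.mul_sum, mul_comm, mul_left_comm] using this
    intro D hD
    have := hle hD A (Submodule.mem_span_singleton_self A)
    simpa only [mul_comm] using this

end Duality

/-! ### Degrees of residue classes -/

section ResidueClasses

open Polynomial

variable {F : Type*} [Field F] {m : ℕ}

theorem mk_rep (k : R F m) : AdjoinRoot.mk (X ^ m) (rep k) = k :=
  AdjoinRoot.mk_leftInverse (monic_X_pow m) k

theorem rep_mk_of_degree_lt {p : F[X]} (hp : p.degree < m) :
    rep (AdjoinRoot.mk (X ^ m) p : R F m) = p := by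
  rw [rep, AdjoinRoot.modByMonicHom_mk, (modByMonic_eq_self_iff (monic_X_pow m)).2]
  rwa [degree_X_pow]

theorem degree_rep_lt (k : R F m) : (rep k).degree < m := by
  rw [← mk_rep k, rep, AdjoinRoot.modByMonicHom_mk]
  simpa using degree_modByMonic_lt (rep k) (monic_X_pow (R := F) m)

theorem rep_eq_zero_iff (k : R F m) : rep k = 0 ↔ k = 0 := by
  constructor
  · intro h
    rw [← mk_rep k, h, map_zero]
  · rintro rfl
    exact map_zero _

theorem rep_sum_smul {ι : Type*} (t : Finset ι) (a : ι → F) (k : ι → R F m) :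
    rep (∑ j ∈ t, a j • k j) = ∑ j ∈ t, a j • rep (k j) := by
  simp only [rep, map_sum, map_smul]

/-- The values `-1` and `⊥` for zero both lie below every natural number, including `d = 0`, so the
two conventions agree here. -/
theorem deg_lt_iff (k : R F m) (d : ℕ) : deg k < d ↔ (rep k).degree < d := by
  by_cases hk : k = 0
  · have h0 : rep k = 0 := (rep_eq_zero_iff k).2 hk
    simp only [deg, hk, if_true, hk ▸ h0, degree_zero, WithBot.bot_lt_natCast, iff_true]
    omega
  · have h0 : rep k ≠ 0 := mt (rep_eq_zero_iff k).1 hk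
    rw [deg, if_neg hk, Nat.cast_lt, natDegree_lt_iff_degree_lt h0]

theorem neg_one_le_deg (k : R F m) : -1 ≤ deg k := by
  unfold deg
  split_ifs <;> omega

theorem deg_nonneg {k : R F m} (hk : k ≠ 0) : 0 ≤ deg k := by
  rw [deg, if_neg hk]
  omega

theorem deg_lt (k : R F m) : deg k < m :=
  (deg_lt_iff k m).2 (degree_rep_lt k)

theorem deg_zero : deg (0 : R F m) = -1 := if_pos rfl

/-- Only an inequality, since for `m = 0` the ring is zero and the degree is `-1`. -/
theorem deg_one_le : deg (1 : R F m) ≤ 0 := by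
  have h : deg (1 : R F m) < (1 : ℕ) := by
    rw [deg_lt_iff]
    rcases Nat.eq_zero_or_pos m with rfl | hm
    · exact (degree_rep_lt _).trans (by norm_num)
    · rw [← map_one (AdjoinRoot.mk (X ^ m)), rep_mk_of_degree_lt]
      · simp
      · simpa using hm
  omega

end ResidueClasses

/-! ### Compatible bases and the filtration by degree -/

section BasisSystems

open Polynomial

variable {F : Type*} [Field F] {s : ℕ}

/-- The common representative of the `j`-th elements of the `i`-th bases. -/
noncomputable def BasisSystem.poly (B : BasisSystem F s) (i : Fin s) (j : ℕ) : F[X] :=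
  rep (B.basis (j + 1) i (Fin.last j))

theorem BasisSystem.rep_basis (B : BasisSystem F s) (m : ℕ) (i : Fin s) (j : Fin m) :
    rep (B.basis m i j) = B.poly i j := by
  induction m with
  | zero => exact j.elim0
  | succ m ih =>
    refine Fin.lastCases ?_ (fun j => ?_) j
    · rfl
    · rw [B.compatible, ih, Fin.val_castSucc]

theorem BasisSystem.degree_poly_lt (B : BasisSystem F s) (i : Fin s) (j : ℕ) :
    (B.poly i j).degree < (j + 1 : ℕ) :=
  degree_rep_lt _

theorem BasisSystem.mk_poly (B : BasisSystem F s) {m : ℕ} (i : Fin s) (j : Fin m) :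
    AdjoinRoot.mk (X ^ m) (B.poly i j) = B.basis m i j := by
  rw [← B.rep_basis, mk_rep]

theorem BasisSystem.rep_eq_sum (B : BasisSystem F s) {m : ℕ} (i : Fin s) (k : R F m) :
    rep k = ∑ r : Fin m, (B.basis m i).equivFun k r • B.poly i r := by
  conv_lhs => rw [← (B.basis m i).sum_equivFun k, rep_sum_smul]
  simp only [B.rep_basis]

/-- The degree of a residue class is determined by its last nonzero coordinate. -/
theorem BasisSystem.deg_lt_iff (B : BasisSystem F s) {m : ℕ} (i : Fin s) (k : R F m) (d : ℕ) :
    deg k < d ↔ ∀ r : Fin m, d ≤ r → (B.basis m i).equivFun k r = 0 := by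
  rw [HyperplaneSeq.deg_lt_iff]
  constructor
  · intro h r hr
    have hdm : d ≤ m := hr.trans r.isLt.le
    -- Representatives of degree below `d` can be expanded in the basis of `R F d`. By compatibility
    -- the same polynomials are the first `d` basis elements modulo `x ^ m`, and coordinates there
    -- are unique.
    set k' : R F d := AdjoinRoot.mk (X ^ d) (rep k)
    have hk' : rep k = ∑ j : Fin d, (B.basis d i).equivFun k' j • B.poly i j := by
      rw [← B.rep_eq_sum, rep_mk_of_degree_lt h]
    have hk : k = ∑ j : Fin d, (B.basis d i).equivFun k' j • B.basis m i (Fin.castLE hdm j) := by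
      rw [← mk_rep k, hk', map_sum]
      refine Finset.sum_congr rfl fun j _ => ?_
      rw [← AdjoinRoot.smul_mk, ← B.mk_poly, Fin.val_castLE]
    rw [hk, map_sum, Finset.sum_apply]
    refine Finset.sum_eq_zero fun j _ => ?_
    have hj : r ≠ Fin.castLE hdm j := fun hrj => by
      have := congrArg Fin.val hrj
      rw [Fin.val_castLE] at this
      omega
    rw [map_smul, Pi.smul_apply, Module.Basis.equivFun_self, if_neg hj.symm, smul_zero]
  · intro h
    rw [B.rep_eq_sum i k, ← mem_degreeLT]
    refine Submodule.sum_mem _ fun r _ => ?_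
    by_cases hr : d ≤ r
    · rw [h r hr, zero_smul]
      exact Submodule.zero_mem _
    · refine Submodule.smul_mem _ _ (mem_degreeLT.2 ((B.degree_poly_lt i r).trans_le ?_))
      exact_mod_cast not_le.1 hr

/-- The basis `1, x, …, x ^ (m - 1)` of the residue class ring modulo `x ^ m`. -/
noncomputable def monomialBasis (F : Type*) [Field F] (m : ℕ) :
    Module.Basis (Fin m) F (R F m) :=
  (AdjoinRoot.powerBasisAux' (monic_X_pow m)).reindex (finCongr (natDegree_X_pow m))

theorem rep_monomialBasis (m : ℕ) (j : Fin m) : rep (monomialBasis F m j) = X ^ (j : ℕ) := by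
  have h := (AdjoinRoot.powerBasis' (monic_X_pow (R := F) m)).basis_eq_pow
    ((finCongr (natDegree_X_pow m)).symm j)
  have h' : monomialBasis F m j = AdjoinRoot.mk (X ^ m) (X ^ (j : ℕ)) := by
    rw [monomialBasis, Module.Basis.reindex_apply, map_pow, AdjoinRoot.mk_X]
    exact h
  rw [h', rep_mk_of_degree_lt]
  rw [degree_X_pow]
  exact_mod_cast j.isLt

/-- The system of the monomial bases `1, x, x², …`. -/
noncomputable def monomialBasisSystem (F : Type*) [Field F] (s : ℕ) : BasisSystem F s where
  basis m _ := monomialBasis F m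
  compatible m _ j := by rw [rep_monomialBasis, rep_monomialBasis, Fin.val_castSucc]

theorem monomialBasisSystem_poly (i : Fin s) (j : ℕ) :
    (monomialBasisSystem F s).poly i j = X ^ j :=
  rep_monomialBasis (j + 1) (Fin.last j)

end BasisSystems
end HyperplaneSeq
namespace HyperplaneSeq

/-! ### Construction of generating matrices -/

section GeneratingMatrices

open Polynomial

variable {F : Type*} [Field F] {s : ℕ}

/-- The matrices with entries `[x ^ c] (α i * b_{i,r})`; they generate a hyperplane sequence. -/
noncomputable def BasisSystem.generatingMatrix (B : BasisSystem F s) (α : Fin s → PowerSeries F) :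
    Fin s → Matrix ℕ ℕ F :=
  fun i r c => PowerSeries.coeff c (α i * (B.poly i r : PowerSeries F))

theorem mem_hyperplane_red_iff (α : Fin s → PowerSeries F) {m : ℕ} (k : Fin s → R F m) :
    k ∈ hyperplane (red α m) ↔
      ∀ c < m, ∑ i, PowerSeries.coeff c (α i * (rep (k i) : PowerSeries F)) = 0 := by
  have h : ∑ i, red α m i * k i
      = AdjoinRoot.mk (X ^ m) (∑ i, PowerSeries.trunc m (α i) * rep (k i)) := by
    simp only [map_sum, map_mul, mk_rep, red]
  change ∑ i, red α m i * k i = 0 ↔ _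
  rw [h, AdjoinRoot.mk_eq_zero, X_pow_dvd_iff]
  refine forall₂_congr fun c hc => ?_
  rw [finsetSum_coeff]
  refine Eq.congr_left (Finset.sum_congr rfl fun i _ => ?_)
  rw [← Polynomial.coeff_coe, Polynomial.coe_mul, PowerSeries.coeff_mul, PowerSeries.coeff_mul]
  refine Finset.sum_congr rfl fun p hp => ?_
  have hp' : p.1 + p.2 = c := Finset.HasAntidiagonal.mem_antidiagonal.1 hp
  -- Coefficients of index below `m` of the product do not see the truncation of `α i`.
  rw [Polynomial.coeff_coe, PowerSeries.coeff_trunc, if_pos (by omega)]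

theorem BasisSystem.theta_mem_space_iff (B : BasisSystem F s) (α : Fin s → PowerSeries F) {m : ℕ}
    (k : Fin s → R F m) : B.theta m k ∈ B.space α m ↔ k ∈ hyperplane (red α m) :=
  Submodule.mem_map.trans ⟨fun ⟨_, hl, h⟩ => (B.theta m).injective h ▸ hl, fun h => ⟨k, h, rfl⟩⟩

theorem BasisSystem.mem_space_iff (B : BasisSystem F s) (α : Fin s → PowerSeries F) {m : ℕ}
    (A : Fin s → Fin m → F) :
    A ∈ B.space α m ↔ ∀ c : Fin m, ∑ i, ∑ r : Fin m, B.generatingMatrix α i r c * A i r = 0 := by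
  obtain ⟨k, rfl⟩ := (B.theta m).surjective A
  rw [B.theta_mem_space_iff, mem_hyperplane_red_iff, Fin.forall_iff]
  refine forall₂_congr fun c hc => Eq.congr_left (Finset.sum_congr rfl fun i _ => ?_)
  have hcoe : (rep (k i) : PowerSeries F)
      = ∑ r : Fin m, (B.basis m i).equivFun (k i) r • (B.poly i r : PowerSeries F) := by
    conv_lhs => rw [B.rep_eq_sum i (k i)]
    rw [← Polynomial.coeToPowerSeries.ringHom_apply, map_sum]
    simp only [Polynomial.coeToPowerSeries.ringHom_apply, Polynomial.coe_smul]
  rw [hcoe, Finset.mul_sum, map_sum]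
  refine Finset.sum_congr rfl fun r _ => ?_
  rw [mul_smul_comm, PowerSeries.coeff_smul, smul_eq_mul, mul_comm]
  rfl

theorem BasisSystem.space_eq (B : BasisSystem F s) (α : Fin s → PowerSeries F) (m : ℕ) :
    B.space α m = dualSpace (rowSpace (B.generatingMatrix α) m) :=
  Submodule.ext fun A => by rw [B.mem_space_iff, mem_dualSpace_rowSpace]

theorem BasisSystem.isHyperplaneGenerating (B : BasisSystem F s) (α : Fin s → PowerSeries F) :
    IsHyperplaneGenerating B α (B.generatingMatrix α) := fun m _ => by
  rw [B.space_eq, dualSpace_dualSpace]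

theorem IsHyperplaneGenerating.theta_mem_iff {B : BasisSystem F s} {α : Fin s → PowerSeries F}
    {C : Fin s → Matrix ℕ ℕ F} (hC : IsHyperplaneGenerating B α C) {m : ℕ} (hm : 1 ≤ m)
    (k : Fin s → R F m) :
    (∀ c : Fin m, ∑ i, ∑ r : Fin m, C i r c * B.theta m k i r = 0) ↔
      k ∈ hyperplane (red α m) := by
  rw [← mem_dualSpace_rowSpace, hC m hm, dualSpace_dualSpace, B.theta_mem_space_iff]

/-- Row `r` holds the coefficients of `α i * x ^ r`, which vanish at `c < r`, while the digits of
`n` vanish at `c ≥ n`. Hence all output digits with index `r ≥ n` are zero. -/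
theorem value_digitalSequence_monomial_mem_Ico [Fintype F] (φ : Fin (Fintype.card F) ≃ F)
    (hφ : φ ⟨0, Fintype.card_pos⟩ = 0) (α : Fin s → PowerSeries F) (n : ℕ) (i : Fin s) :
    value (digitalSequence φ ((monomialBasisSystem F s).generatingMatrix α) n i)
      ∈ Set.Ico (0 : ℝ) 1 := by
  refine value_mem_Ico _ n fun r hr => ?_
  have h0 : ∀ c, (monomialBasisSystem F s).generatingMatrix α i r c * φ (digit F n c) = 0 := by
    intro c
    by_cases hc : c < r
    · rw [BasisSystem.generatingMatrix, monomialBasisSystem_poly, Polynomial.coe_pow,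
        Polynomial.coe_X, PowerSeries.coeff_mul_X_pow', if_neg (not_le.2 hc), zero_mul]
    · have hn : n < Fintype.card F ^ c := (Nat.lt_pow_self Fintype.one_lt_card).trans_le
        (Nat.pow_le_pow_right Fintype.card_pos (hr.trans (not_lt.1 hc)))
      rw [digit_eq_zero hn, hφ, mul_zero]
  simp only [digitalSequence, h0, finsum_zero]
  rw [← hφ, Equiv.symm_apply_apply]

end GeneratingMatrices

/-! ### Bounds for the figure of merit -/

section FigureOfMerit

open Polynomial

variable {F : Type*} [Field F] {s m : ℕ}

theorem isUnit_red {α : Fin s → PowerSeries F} {i : Fin s} (hα : α i ∈ Y F) (hm : 1 ≤ m) :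
    IsUnit (red α m i) := by
  obtain ⟨u, v, h⟩ := hα m hm
  refine IsUnit.of_mul_eq_one (AdjoinRoot.mk (X ^ m) u) ?_
  have := congrArg (AdjoinRoot.mk (X ^ m)) h
  rwa [map_add, map_mul, map_mul, AdjoinRoot.mk_self, mul_zero, add_zero, map_one,
    mul_comm] at this

theorem sum_deg_add_one (k : Fin s → R F m) : ∑ i, (deg (k i) + 1) = ∑ i, deg (k i) + s := by
  simp [Finset.sum_add_distrib]

theorem bddBelow_sum_deg (a : Fin s → R F m) :
    BddBelow {n : ℤ | ∃ k ∈ hyperplane a, k ≠ 0 ∧ n = ∑ i, deg (k i)} := by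
  refine ⟨-s, ?_⟩
  rintro _ ⟨l, -, -, rfl⟩
  have := Finset.sum_nonneg (s := Finset.univ) (f := fun i => deg (l i) + 1)
    fun i _ => by linarith [neg_one_le_deg (l i)]
  rw [sum_deg_add_one] at this
  linarith

/-- The shifted degree `deg + 1` is a nonnegative weight, zero only at `0`, and `ρ + 1` is the
minimum total weight, the minimum distance of the hyperplane. -/
theorem figureOfMerit_le {a k : Fin s → R F m} (hk : k ∈ hyperplane a) (hk0 : k ≠ 0) :
    figureOfMerit a + 1 ≤ ∑ i, (deg (k i) + 1) := by
  have hne : hyperplane a ≠ ⊥ := fun h => hk0 ((Submodule.mem_bot F).1 (h ▸ hk))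
  have := csInf_le (bddBelow_sum_deg a) ⟨k, hk, hk0, rfl⟩
  rw [figureOfMerit, if_neg hne, sum_deg_add_one]
  linarith

theorem exists_sum_deg_eq_figureOfMerit {a : Fin s → R F m} (ha : hyperplane a ≠ ⊥) :
    ∃ k ∈ hyperplane a, k ≠ 0 ∧ ∑ i, (deg (k i) + 1) = figureOfMerit a + 1 := by
  obtain ⟨l, hl, hl0⟩ := (Submodule.ne_bot_iff _).1 ha
  obtain ⟨k, hk, hk0, h⟩ := Int.csInf_mem
    (s := {n : ℤ | ∃ k ∈ hyperplane a, k ≠ 0 ∧ n = ∑ i, deg (k i)})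
    ⟨_, l, hl, hl0, rfl⟩ (bddBelow_sum_deg a)
  refine ⟨k, hk, hk0, ?_⟩
  rw [figureOfMerit, if_neg ha, h, sum_deg_add_one]
  ring

theorem figureOfMerit_nonneg (a : Fin s → R F m) : 0 ≤ figureOfMerit a := by
  by_cases ha : hyperplane a = ⊥
  · rw [figureOfMerit, if_pos ha]
    positivity
  · obtain ⟨k, -, hk0, h⟩ := exists_sum_deg_eq_figureOfMerit ha
    obtain ⟨i, hi⟩ := Function.ne_iff.1 hk0
    have h1 := Finset.single_le_sum (s := Finset.univ) (f := fun i => deg (k i) + 1)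
      (fun i _ => by linarith [neg_one_le_deg (k i)]) (Finset.mem_univ i)
    have h2 := deg_nonneg hi
    linarith

/-- A vector of two or more units is orthogonal to a vector with one entry `1` and only one other
nonzero entry. -/
theorem exists_mem_hyperplane_of_isUnit (hm : 1 ≤ m) {a : Fin s → R F m} {i j : Fin s}
    (hij : i ≠ j) (ha : IsUnit (a i)) :
    ∃ k ∈ hyperplane a, k ≠ 0 ∧ ∑ l, (deg (k l) + 1) ≤ m + 1 := by
  obtain ⟨u, hu⟩ := ha.exists_right_inv
  -- With `u` inverse to `a i`, the entry at `i` cancels the contribution `a j` of the entry `1` at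
  -- `j`. The weights are at most `m` and `1`.
  refine ⟨Function.update (Pi.single j 1) i (-u * a j), ?_, ?_, ?_⟩
  · change ∑ l, a l * _ = 0
    rw [← Finset.add_sum_erase _ _ (Finset.mem_univ i),
      Finset.sum_eq_single_of_mem j (Finset.mem_erase.2 ⟨hij.symm, Finset.mem_univ j⟩)]
    · rw [Function.update_self, Function.update_of_ne hij.symm, Pi.single_eq_same]
      linear_combination (-a j) * hu
    · intro l hl hlj
      rw [Function.update_of_ne (Finset.ne_of_mem_erase hl), Pi.single_eq_of_ne hlj, mul_zero]
  · have hnt : Nontrivial (R F m) := AdjoinRoot.nontrivial _ (by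
      rw [degree_X_pow]; exact_mod_cast (by omega : m ≠ 0))
    intro h
    have := congrFun h j
    rw [Function.update_of_ne hij.symm, Pi.single_eq_same] at this
    exact one_ne_zero this
  · rw [← Finset.add_sum_erase _ _ (Finset.mem_univ i),
      Finset.sum_eq_single_of_mem j (Finset.mem_erase.2 ⟨hij.symm, Finset.mem_univ j⟩)]
    · rw [Function.update_self, Function.update_of_ne hij.symm, Pi.single_eq_same]
      linarith [Int.add_one_le_iff.2 (deg_lt (-u * a j)), deg_one_le (F := F) (m := m)]
    · intro l hl hlj
      rw [Function.update_of_ne (Finset.ne_of_mem_erase hl), Pi.single_eq_of_ne hlj, deg_zero]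
      norm_num

/-- For `s = 1` the bound comes from the convention for the zero space or from `deg < m`; for `s ≥
2` an explicit vector has weight at most `m + 1`. -/
theorem figureOfMerit_le_of_isUnit (hm : 1 ≤ m) (hs : 1 ≤ s) {a : Fin s → R F m}
    (ha : ∀ i, IsUnit (a i)) : figureOfMerit a ≤ m := by
  rcases hs.eq_or_lt with rfl | hs
  · by_cases h : hyperplane a = ⊥
    · rw [figureOfMerit, if_pos h, Nat.cast_one, one_mul]
    · obtain ⟨k, hk, -, h⟩ := exists_sum_deg_eq_figureOfMerit h
      rw [Fin.sum_univ_one] at h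
      linarith [deg_lt (k 0)]
  · obtain ⟨k, hk, hk0, h⟩ := exists_mem_hyperplane_of_isUnit hm (i := ⟨0, by omega⟩)
      (j := ⟨1, hs⟩) (by simp) (ha _)
    linarith [figureOfMerit_le hk hk0]

theorem hyperplane_ne_bot_of_figureOfMerit_lt (hs : 1 ≤ s) {a : Fin s → R F m}
    (h : figureOfMerit a < m) : hyperplane a ≠ ⊥ := by
  intro hbot
  rw [figureOfMerit, if_pos hbot] at h
  have : (1 : ℤ) * m ≤ s * m := by gcongr; exact_mod_cast hs
  linarith

end FigureOfMerit

/-! ### Independence, figure of merit and strictness -/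

section Main

variable {F : Type*} [Field F] {s : ℕ}

/-- The leading rows of generating matrices of a hyperplane sequence are independent exactly up to
the figure of merit. -/
theorem IsHyperplaneGenerating.independent_iff {B : BasisSystem F s} {α : Fin s → PowerSeries F}
    {C : Fin s → Matrix ℕ ℕ F} (hC : IsHyperplaneGenerating B α C) (hs : 1 ≤ s) {m t : ℕ}
    (hm : 1 ≤ m) :
    (∀ d : Fin s → ℕ, ∑ i, d i + t = m → ∀ A : Fin s → Fin m → F,
        (∀ i (r : Fin m), d i ≤ r → A i r = 0) →
        (∀ c : Fin m, ∑ i, ∑ r : Fin m, C i r c * A i r = 0) → A = 0) ↔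
      (m : ℤ) - figureOfMerit (red α m) ≤ t := by
  constructor
  · intro h
    by_contra! hlt
    obtain ⟨k, hk, hk0, hsum⟩ := exists_sum_deg_eq_figureOfMerit
      (hyperplane_ne_bot_of_figureOfMerit_lt hs (by omega : figureOfMerit (red α m) < m))
    have hd : ∀ i, ((deg (k i) + 1).toNat : ℤ) = deg (k i) + 1 := fun i =>
      Int.toNat_of_nonneg (by linarith [neg_one_le_deg (k i)])
    have hle : ∑ i, (deg (k i) + 1).toNat + t ≤ m := by
      zify
      rw [Finset.sum_congr rfl fun i _ => hd i]
      linarith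
    -- A minimal vector has weight at most `m - t`. Adding the slack `e` to one coordinate makes the
    -- sum exact and only weakens the vanishing condition on the relation.
    obtain ⟨e, he⟩ := Nat.exists_eq_add_of_le hle
    have h0 := h (fun i => (deg (k i) + 1).toNat + if i = ⟨0, hs⟩ then e else 0)
      (by rw [Finset.sum_add_distrib, Finset.sum_ite_eq' Finset.univ, if_pos (Finset.mem_univ _)]
          omega)
      (B.theta m k)
      (fun i r hr => (B.deg_lt_iff i (k i) (deg (k i) + 1).toNat).1
        (by linarith [hd i]) r ((Nat.le_add_right _ _).trans hr))
      ((hC.theta_mem_iff hm k).2 hk)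
    exact hk0 ((B.theta m).map_eq_zero_iff.1 h0)
  · intro h d hd A hA hCA
    obtain ⟨k, rfl⟩ := (B.theta m).surjective A
    have hk := (hC.theta_mem_iff hm k).1 hCA
    by_contra hk0
    have hmin := figureOfMerit_le hk fun h0 => hk0 (by rw [h0, map_zero])
    have hdeg : ∑ i, (deg (k i) + 1) ≤ ∑ i, (d i : ℤ) := Finset.sum_le_sum fun i _ =>
      Int.add_one_le_iff.2 ((B.deg_lt_iff i (k i) (d i)).2 (hA i))
    have hd' : ∑ i, (d i : ℤ) + t = m := by exact_mod_cast hd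
    linarith

theorem IsHyperplaneGenerating.isStrictTSequence [Fintype F] {B : BasisSystem F s}
    {α : Fin s → PowerSeries F} {C : Fin s → Matrix ℕ ℕ F} (hC : IsHyperplaneGenerating B α C)
    (hs : 1 ≤ s) (φ : Fin (Fintype.card F) ≃ F) (hφ : φ ⟨0, Fintype.card_pos⟩ = 0) {I : Set ℝ}
    (hI : ∀ n i, value (digitalSequence φ C n i) ∈ I) {T : ℕ → ℕ} (hTle : ∀ m, T m ≤ m)
    (hT : ∀ m, 1 ≤ m → (T m : ℤ) = m - figureOfMerit (red α m)) :
    IsStrictTSequence I T (digitalSequence φ C) := by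
  refine ⟨⟨hTle, hI, fun m k => ?_⟩, fun m t ht hseq => ?_⟩
  · rw [isNet_digitalSequence_iff φ hφ C (hTle m)]
    rcases Nat.eq_zero_or_pos m with rfl | hm
    -- For `m = 0` there are no coefficients, so independence is vacuous; the hyperplane condition
    -- says nothing about this case.
    · exact fun _ _ _ _ _ => funext fun _ => Subsingleton.elim _ _
    · exact (hC.independent_iff hs hm).2 (hT m hm).ge
  · have hm : 1 ≤ m := by have := hTle m; omega
    have htm : t ≤ m := ht.le.trans (hTle m)
    -- The block `k = 0` already refutes a smaller value.
    have hnet := hseq.isNet m 0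
    rw [Function.update_self, isNet_digitalSequence_iff φ hφ C htm,
      hC.independent_iff hs hm, ← hT m hm] at hnet
    omega

end Main
end HyperplaneSeq

theorem mainTheorem4 {F : Type*} [Field F] [Fintype F]
    (φ : Fin (Fintype.card F) ≃ F) (hφ : φ ⟨0, Fintype.card_pos⟩ = 0)
    (s : ℕ) (hs : 1 ≤ s)
    (α : Fin s → PowerSeries F) (hα : ∀ i, α i ∈ HyperplaneSeq.Y F) :
    ∃ T : ℕ → ℕ,
      (∀ m : ℕ, 1 ≤ m →
        (T m : ℤ) = (m : ℤ) - HyperplaneSeq.figureOfMerit (HyperplaneSeq.red α m)) ∧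
      (∃ (B : HyperplaneSeq.BasisSystem F s) (C : Fin s → Matrix ℕ ℕ F),
        HyperplaneSeq.IsHyperplaneGenerating B α C ∧
        HyperplaneSeq.IsStrictTSequence (Set.Ico 0 1) T
          (HyperplaneSeq.digitalSequence φ C)) ∧
      (∀ B : HyperplaneSeq.BasisSystem F s,
        (∃ C : Fin s → Matrix ℕ ℕ F, HyperplaneSeq.IsHyperplaneGenerating B α C) ∧
        ∀ C : Fin s → Matrix ℕ ℕ F, HyperplaneSeq.IsHyperplaneGenerating B α C →
          HyperplaneSeq.IsStrictTSequence (Set.Icc 0 1) T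
            (HyperplaneSeq.digitalSequence φ C)) := by

  have hρ : ∀ m, 1 ≤ m → HyperplaneSeq.figureOfMerit (HyperplaneSeq.red α m) ≤ m := fun m hm =>
    HyperplaneSeq.figureOfMerit_le_of_isUnit hm hs fun i => HyperplaneSeq.isUnit_red (hα i) hm
  -- The formula is required only for `m ≥ 1`; at `0` the condition `T m ≤ m` forces the value `0`.
  let T : ℕ → ℕ := fun m =>
    if m = 0 then 0 else ((m : ℤ) - HyperplaneSeq.figureOfMerit (HyperplaneSeq.red α m)).toNat
  have hT : ∀ m : ℕ, 1 ≤ m →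
      (T m : ℤ) = (m : ℤ) - HyperplaneSeq.figureOfMerit (HyperplaneSeq.red α m) := fun m hm => by
    simp only [T, if_neg (by omega : m ≠ 0)]
    exact Int.toNat_of_nonneg (by linarith [hρ m hm])
  have hTle : ∀ m, T m ≤ m := fun m => by
    rcases Nat.eq_zero_or_pos m with rfl | hm
    · simp [T]
    · have h1 := hT m hm
      have h2 := HyperplaneSeq.figureOfMerit_nonneg (HyperplaneSeq.red α m)
      omega
  refine ⟨T, hT, ?_, fun B => ⟨⟨_, B.isHyperplaneGenerating α⟩, fun C hC => ?_⟩⟩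
  · have hC := (HyperplaneSeq.monomialBasisSystem F s).isHyperplaneGenerating α
    exact ⟨_, _, hC, hC.isStrictTSequence hs φ hφ
      (HyperplaneSeq.value_digitalSequence_monomial_mem_Ico φ hφ α) hTle hT⟩
  · exact hC.isStrictTSequence hs φ hφ (fun _ _ => HyperplaneSeq.value_mem_Icc _) hTle hT
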